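/- Let $\mathbb D=\{z\in\mathbb C:|z|<1\}$, and let $\mathcal A$ be the class of analytic functions on $\mathbb D$ of the form $f(z)=z+\sum_{n=2}^{\infty}a_nz^n$. For functions $g,h$ analytic on $\mathbb D$ write $g\prec h$ if there is an analytic function $\omega$ on $\mathbb D$ with $|\omega(z)|\le|z|$ and $g(z)=h(\omega(z))$ for all $z\in\mathbb D$. Let $\mathcal G_{sh}$ be the class of all $f\in\mathcal A$ with $f(z)\neq0$ for $0<|z|<1$ and $$\frac{zf'(z)}{f(z)}-1\prec\sinh z,$$ where the quotient $zf'(z)/f(z)$ is given its limit value $1$ at $z=0$. **Theorem.** If $f(z)=z+\sum_{n=2}^{\infty}a_nz^n$ belongs to $\mathcal G_{sh}$, then $$|a_2|\le1,\qquad |a_3|\le\tfrac12,\qquad |a_4|\le\tfrac13,\qquad |a_5|\le\tfrac14 .$$ Each bound is sharp: for each $n\in\{2,3,4,5\}$ the function $$f_n(z)=z\exp\left(\int_0^z\frac{\sinh(t^{n-1})}{t}\,dt\right)$$ belongs to $\mathcal G_{sh}$, and its $n$-th coefficient satisfies $|a_n|=\frac1{n-1}$. -/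

import Mathlib

/-- The open unit disc of the complex plane. -/
def unitDisc : Set ℂ := Metric.ball 0 1

/-- `f` is of the form `f(z) = z + ∑_{n ≥ 2} a_n z ^ n` on the open unit disc
(the values `a 0` and `a 1` play no role). -/
def HasNormalizedExpansion (f : ℂ → ℂ) (a : ℕ → ℂ) : Prop :=
  ∀ z ∈ unitDisc, HasSum (fun n : ℕ => a (n + 2) * z ^ (n + 2)) (f z - z)

/-- The class `𝒜` of analytic functions on the open unit disc of the form
`z + ∑_{n ≥ 2} a_n z ^ n`. -/
def classA : Set (ℂ → ℂ) :=
  {f | DifferentiableOn ℂ f unitDisc ∧ ∃ a : ℕ → ℂ, HasNormalizedExpansion f a}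

/-- Schwarz functions: analytic self-maps `ω` of the unit disc with `|ω(z)| ≤ |z|`. -/
def IsSchwarz (ω : ℂ → ℂ) : Prop :=
  DifferentiableOn ℂ ω unitDisc ∧ ∀ z ∈ unitDisc, ‖ω z‖ ≤ ‖z‖

/-- Subordination `g ≺ h` on the unit disc. -/
def Subordinate (g h : ℂ → ℂ) : Prop :=
  ∃ ω : ℂ → ℂ, IsSchwarz ω ∧ ∀ z ∈ unitDisc, g z = h (ω z)

open Classical in
/-- The function `z f'(z) / f(z)`, with its removable singularity at `0` filled in
(for `f(z) = z + ⋯` its limit at `0` is `1`). -/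
noncomputable def starQuotient (f : ℂ → ℂ) (z : ℂ) : ℂ :=
  if z = 0 then 1 else z * deriv f z / f z

/-- The class `𝒢_sh` of those `f ∈ 𝒜` with `z f'(z) / f(z) - 1 ≺ sinh z`. The condition that `f`
has no zero in the punctured disc says that the quotient is defined there. -/
def classGsh : Set (ℂ → ℂ) :=
  {f | f ∈ classA ∧ (∀ z ∈ unitDisc, z ≠ 0 → f z ≠ 0) ∧
    Subordinate (fun z => starQuotient f z - 1) Complex.sinh}

/-- The integral `∫_0^z g(t) dt` along the segment `t = u z`, `0 ≤ u ≤ 1`. -/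
noncomputable def segmentIntegral (g : ℂ → ℂ) (z : ℂ) : ℂ :=
  ∫ u in (0 : ℝ)..1, g ((u : ℂ) * z) * z

/-- The function `z exp (∫_0^z sinh (t ^ (n - 1)) / t dt)`, for `n ≥ 2`. -/
noncomputable def extremalFunction (n : ℕ) (z : ℂ) : ℂ :=
  z * Complex.exp (segmentIntegral (fun t => Complex.sinh (t ^ (n - 1)) / t) z)

/-! Write `z f' = f (1 + sinh ω)` with `ω = ∑ c_k z^k` a Schwarz function. Comparing coefficients
makes each `(n - 1) a_n` a polynomial in `c 1, …, c (n - 1)` (`coeff_eq_of_mul_deriv_eq`), and the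
bounds say that these polynomials have modulus at most `1`.

Since `|ω| ≤ 1`, multiplication by `ω` is an `ℓ²` contraction on coefficients
(`IsSchwarz.sum_sq_coeff_mul_le`). Apply it to `p = 1 + h₁ z + h₂ z² + h₃ z³`, with the `h_j`
depending on the `c_k` so that one coefficient of `ω p` is the required polynomial. The lower
coefficients of `ω p` then absorb `|h₁|² + |h₂|² + |h₃|²`, leaving the bound `1`
(`IsSchwarz.coeff_functional_bounds`).

Equality comes from `ω = z^(n - 1)`: only `c (n - 1) = 1` survives, so `(n - 1) a_n = 1`. -/

/-! ### Taylor series at the origin -/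

/-- The Taylor series at `0` of a complex function, as a formal power series. -/
noncomputable def taylorSeriesAtZero (g : ℂ → ℂ) : PowerSeries ℂ :=
  PowerSeries.mk fun n => iteratedDeriv n g 0 / (n.factorial : ℂ)

lemma coeff_taylorSeriesAtZero (g : ℂ → ℂ) (n : ℕ) :
    PowerSeries.coeff n (taylorSeriesAtZero g) = iteratedDeriv n g 0 / (n.factorial : ℂ) := by
  simp [taylorSeriesAtZero]

lemma coeff_zero_taylorSeriesAtZero (g : ℂ → ℂ) :
    PowerSeries.coeff 0 (taylorSeriesAtZero g) = g 0 := by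
  simp [coeff_taylorSeriesAtZero]

lemma taylorSeriesAtZero_congr {g h : ℂ → ℂ} (hgh : g =ᶠ[nhds 0] h) :
    taylorSeriesAtZero g = taylorSeriesAtZero h := by
  ext n
  rw [coeff_taylorSeriesAtZero, coeff_taylorSeriesAtZero, hgh.iteratedDeriv_eq]

lemma taylorSeriesAtZero_mul {g h : ℂ → ℂ} (hg : AnalyticAt ℂ g 0) (hh : AnalyticAt ℂ h 0) :
    taylorSeriesAtZero (g * h) = taylorSeriesAtZero g * taylorSeriesAtZero h := by
  ext n
  simp only [PowerSeries.coeff_mul, coeff_taylorSeriesAtZero]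
  rw [iteratedDeriv_mul hg.contDiffAt hh.contDiffAt,
    Finset.Nat.sum_antidiagonal_eq_sum_range_succ_mk, Finset.sum_div]
  refine Finset.sum_congr rfl fun i hi => ?_
  rw [Nat.cast_choose _ (Nat.lt_succ_iff.mp (Finset.mem_range.mp hi))]
  field_simp [Nat.factorial_ne_zero]

lemma taylorSeriesAtZero_deriv (g : ℂ → ℂ) :
    taylorSeriesAtZero (deriv g) = PowerSeries.derivative ℂ (taylorSeriesAtZero g) := by
  ext n
  rw [PowerSeries.coeff_derivative, coeff_taylorSeriesAtZero, coeff_taylorSeriesAtZero,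
    iteratedDeriv_succ', Nat.factorial_succ]
  push_cast
  have h1 : (n.factorial : ℂ) ≠ 0 := by exact_mod_cast n.factorial_ne_zero
  have h2 : (n : ℂ) + 1 ≠ 0 := by exact_mod_cast n.succ_ne_zero
  field_simp

lemma taylorSeriesAtZero_add {g h : ℂ → ℂ} (hg : AnalyticAt ℂ g 0) (hh : AnalyticAt ℂ h 0) :
    taylorSeriesAtZero (g + h) = taylorSeriesAtZero g + taylorSeriesAtZero h := by
  ext n
  simp only [map_add, coeff_taylorSeriesAtZero]
  rw [iteratedDeriv_add hg.contDiffAt hh.contDiffAt, add_div]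

lemma taylorSeriesAtZero_pow (m : ℕ) : taylorSeriesAtZero (fun z => z ^ m) = PowerSeries.X ^ m := by
  ext n
  rw [coeff_taylorSeriesAtZero, iteratedDeriv_fun_pow_zero, PowerSeries.coeff_X_pow]
  split_ifs with h
  · subst h
    exact div_self (by exact_mod_cast n.factorial_ne_zero)
  · simp

lemma taylorSeriesAtZero_id : taylorSeriesAtZero id = PowerSeries.X := by
  have h : (id : ℂ → ℂ) = fun z => z ^ 1 := by simp [funext_iff]
  rw [h, taylorSeriesAtZero_pow, pow_one]

lemma HasFPowerSeriesAt.coeff_taylorSeriesAtZero {g : ℂ → ℂ} {p : FormalMultilinearSeries ℂ ℂ ℂ}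
    (hp : HasFPowerSeriesAt g p 0) (n : ℕ) :
    PowerSeries.coeff n (taylorSeriesAtZero g) = p.coeff n := by
  rw [hp.eq_formalMultilinearSeries hp.analyticAt.hasFPowerSeriesAt,
    FormalMultilinearSeries.coeff_ofScalars, _root_.coeff_taylorSeriesAtZero]

lemma coeff_taylorSeriesAtZero_eq_of_hasSum {g : ℂ → ℂ} {b : ℕ → ℂ}
    (h : ∀ z ∈ unitDisc, HasSum (fun n => b n * z ^ n) (g z)) (n : ℕ) :
    PowerSeries.coeff n (taylorSeriesAtZero g) = b n := by
  have hp : HasFPowerSeriesAt g (FormalMultilinearSeries.ofScalars ℂ b) 0 := by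
    rw [hasFPowerSeriesAt_iff]
    filter_upwards [Metric.ball_mem_nhds (0 : ℂ) one_pos] with z hz
    simpa [FormalMultilinearSeries.coeff_ofScalars, mul_comm] using h z hz
  rw [hp.coeff_taylorSeriesAtZero, FormalMultilinearSeries.coeff_ofScalars]

lemma hasSum_taylorSeriesAtZero {g : ℂ → ℂ} (hg : DifferentiableOn ℂ g unitDisc) {z : ℂ}
    (hz : z ∈ unitDisc) :
    HasSum (fun n => PowerSeries.coeff n (taylorSeriesAtZero g) * z ^ n) (g z) := by
  have h := Complex.hasSum_taylorSeries_on_ball hg hz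
  simp only [sub_zero, smul_eq_mul] at h
  simp only [coeff_taylorSeriesAtZero, div_eq_inv_mul, mul_assoc]
  simpa only [mul_comm (z ^ _)] using h

lemma analyticAt_zero_of_differentiableOn {g : ℂ → ℂ} (hg : DifferentiableOn ℂ g unitDisc) :
    AnalyticAt ℂ g 0 :=
  hg.analyticAt (Metric.ball_mem_nhds _ one_pos)

lemma taylorSeriesAtZero_eval (p : Polynomial ℂ) :
    taylorSeriesAtZero (fun z => p.eval z) = (p : PowerSeries ℂ) := by
  ext n
  rw [Polynomial.coeff_coe]
  refine coeff_taylorSeriesAtZero_eq_of_hasSum (fun z _ => ?_) n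
  rw [Polynomial.eval_eq_sum, Polynomial.sum]
  exact hasSum_sum_of_ne_finset_zero fun k hk => by simp [Polynomial.notMem_support_iff.mp hk]

/-! ### Parseval on circles and the contraction property -/

/-- This is Cauchy's coefficient formula on the circle of radius `r`, parametrized by angle. -/
lemma fourierCoeffOn_circleMap_eq {g : ℂ → ℂ} (hg : DifferentiableOn ℂ g unitDisc)
    {r : ℝ} (hr0 : 0 < r) (hr1 : r < 1) (n : ℕ) :
    fourierCoeffOn Real.two_pi_pos (fun θ => g (circleMap 0 r θ)) n =
      r ^ n * PowerSeries.coeff n (taylorSeriesAtZero g) := by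
  have hd : DiffContOnCl ℂ g (Metric.ball 0 (⟨r, hr0.le⟩ : NNReal)) := by
    apply DifferentiableOn.diffContOnCl
    rw [closure_ball _ (by simpa using hr0.ne')]
    exact hg.mono (Metric.closedBall_subset_ball hr1)
  have hp := (hd.hasFPowerSeriesOnBall (by exact_mod_cast hr0)).hasFPowerSeriesAt
  have hr : (r : ℂ) ≠ 0 := by exact_mod_cast hr0.ne'
  rw [hp.coeff_taylorSeriesAtZero, FormalMultilinearSeries.coeff]
  change _ = _ * cauchyPowerSeries g 0 r n (fun _ => 1)
  rw [cauchyPowerSeries_apply, fourierCoeffOn_eq_integral, circleIntegral,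
    ← intervalIntegral.integral_smul, ← intervalIntegral.integral_smul,
    ← intervalIntegral.integral_const_mul]
  refine intervalIntegral.integral_congr fun θ _ => ?_
  have hpi : (Real.pi : ℂ) ≠ 0 := by exact_mod_cast Real.pi_ne_zero
  have he : Complex.exp (θ * Complex.I) ≠ 0 := Complex.exp_ne_zero _
  have h1 : fourier (-(n : ℤ)) (θ : AddCircle (2 * Real.pi - 0)) =
      (Complex.exp (θ * Complex.I) ^ n)⁻¹ := by
    rw [fourier_coe_apply, ← Complex.exp_nat_mul, ← Complex.exp_neg]
    congr 1
    push_cast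
    field_simp
    ring
  simp only [h1, smul_eq_mul, sub_zero, deriv_circleMap, circleMap_zero, Complex.real_smul]
  push_cast
  rw [div_pow, one_pow, mul_pow]
  field_simp

/-- Parseval turns both sides into means of squared moduli over the circle of radius `r`, where `|g|
≤ |p|` pointwise. -/
theorem sum_sq_coeff_taylorSeriesAtZero_le {g : ℂ → ℂ} (hg : DifferentiableOn ℂ g unitDisc)
    (p : Polynomial ℂ) (hgp : ∀ z ∈ unitDisc, ‖g z‖ ≤ ‖p.eval z‖) {r : ℝ} (hr0 : 0 < r)
    (hr1 : r < 1) (s : Finset ℕ) :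
    ∑ k ∈ s, (r ^ k * ‖PowerSeries.coeff k (taylorSeriesAtZero g)‖) ^ 2 ≤
      ∑ k ∈ p.support, ‖p.coeff k‖ ^ 2 := by
  have hmem : ∀ θ, circleMap 0 r θ ∈ unitDisc := fun θ => by
    simpa [unitDisc, abs_of_pos hr0] using hr1
  have hcont : Continuous fun θ => g (circleMap 0 r θ) :=
    hg.continuousOn.comp_continuous (continuous_circleMap 0 r) hmem
  have hL2 : MeasureTheory.MemLp (fun θ => g (circleMap 0 r θ)) 2
      (MeasureTheory.volume.restrict (Set.Ioc 0 (2 * Real.pi))) := by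
    obtain ⟨C, hC⟩ := isCompact_Icc.exists_bound_of_continuousOn
      (hcont.continuousOn (s := Set.Icc 0 (2 * Real.pi)))
    refine MeasureTheory.MemLp.of_bound hcont.aestronglyMeasurable C ?_
    filter_upwards [MeasureTheory.ae_restrict_mem measurableSet_Ioc] with θ hθ
    exact hC θ (Set.Ioc_subset_Icc_self hθ)
  have hsum := hasSum_sq_fourierCoeffOn Real.two_pi_pos hL2
  -- Rescaling by `r` moves `p` to the unit circle, where Parseval for polynomials applies.
  set q : Polynomial ℂ := p.comp (Polynomial.C (r : ℂ) * Polynomial.X) with hq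
  have hqc : ∀ k, q.coeff k = p.coeff k * (r : ℂ) ^ k := fun k => by
    rw [hq, Polynomial.comp_C_mul_X_coeff]
  have hqe : ∀ θ, p.eval (circleMap 0 r θ) = q.eval (circleMap 0 1 θ) := fun θ => by
    simp [hq, circleMap_zero]
  calc ∑ k ∈ s, (r ^ k * ‖PowerSeries.coeff k (taylorSeriesAtZero g)‖) ^ 2
      = ∑ k ∈ s.map Nat.castEmbedding,
          ‖fourierCoeffOn Real.two_pi_pos (fun θ => g (circleMap 0 r θ)) k‖ ^ 2 := by
        rw [Finset.sum_map]
        refine Finset.sum_congr rfl fun k _ => ?_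
        rw [Nat.castEmbedding_apply, fourierCoeffOn_circleMap_eq hg hr0 hr1, norm_mul,
          norm_pow, Complex.norm_real, Real.norm_of_nonneg hr0.le]
    _ ≤ (2 * Real.pi - 0)⁻¹ • ∫ θ in (0 : ℝ)..2 * Real.pi, ‖g (circleMap 0 r θ)‖ ^ 2 :=
        sum_le_hasSum _ (fun _ _ => by positivity) hsum
    _ ≤ Real.circleAverage (fun z => ‖q.eval z‖ ^ 2) 0 1 := by
        rw [Real.circleAverage_def, sub_zero, smul_eq_mul, smul_eq_mul]
        refine mul_le_mul_of_nonneg_left ?_ (by positivity)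
        refine intervalIntegral.integral_mono_on Real.two_pi_pos.le ?_ ?_ fun θ _ => ?_
        · exact (hcont.norm.pow 2).intervalIntegrable _ _
        · exact ((q.continuous.comp (continuous_circleMap 0 1)).norm.pow 2).intervalIntegrable _ _
        · rw [← hqe]
          exact pow_le_pow_left₀ (norm_nonneg _) (hgp _ (hmem θ)) 2
    _ = ∑ k ∈ q.support, ‖q.coeff k‖ ^ 2 := q.sum_sq_norm_coeff_eq_circleAverage.symm
    _ ≤ ∑ k ∈ p.support, ‖q.coeff k‖ ^ 2 := by
        refine Finset.sum_le_sum_of_subset_of_nonneg (fun k hk => ?_) fun _ _ _ => by positivity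
        rw [Polynomial.mem_support_iff] at hk ⊢
        rw [hqc] at hk
        exact left_ne_zero_of_mul hk
    _ ≤ ∑ k ∈ p.support, ‖p.coeff k‖ ^ 2 := by
        refine Finset.sum_le_sum fun k _ => pow_le_pow_left₀ (norm_nonneg _) ?_ 2
        rw [hqc, norm_mul, norm_pow, Complex.norm_real, Real.norm_of_nonneg hr0.le]
        exact mul_le_of_le_one_right (norm_nonneg _) (pow_le_one₀ hr0.le hr1.le)

/-- A Schwarz function multiplies polynomials contractively in the `ℓ²` norm of coefficients. -/
theorem IsSchwarz.sum_sq_coeff_mul_le {ω : ℂ → ℂ} (hω : IsSchwarz ω) (p : Polynomial ℂ)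
    (s : Finset ℕ) :
    ∑ k ∈ s, ‖PowerSeries.coeff k (taylorSeriesAtZero ω * (p : PowerSeries ℂ))‖ ^ 2 ≤
      ∑ k ∈ p.support, ‖p.coeff k‖ ^ 2 := by
  have hdp : DifferentiableOn ℂ (fun z => p.eval z) unitDisc := p.differentiable.differentiableOn
  have hg : DifferentiableOn ℂ (ω * fun z => p.eval z) unitDisc := hω.1.mul hdp
  have hT : taylorSeriesAtZero (ω * fun z => p.eval z) =
      taylorSeriesAtZero ω * (p : PowerSeries ℂ) := by
    rw [taylorSeriesAtZero_mul (analyticAt_zero_of_differentiableOn hω.1)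
      (analyticAt_zero_of_differentiableOn hdp), taylorSeriesAtZero_eval]
  have hle : ∀ z ∈ unitDisc, ‖(ω * fun z => p.eval z) z‖ ≤ ‖p.eval z‖ := fun z hz => by
    rw [Pi.mul_apply, norm_mul]
    refine mul_le_of_le_one_left (norm_nonneg _) ((hω.2 z hz).trans ?_)
    simpa [unitDisc] using (mem_ball_zero_iff.mp hz).le
  rw [← hT]
  -- The bound for `r < 1` has a right side independent of `r`, so `r → 1` removes the weights.
  have hlim : Filter.Tendsto (fun r : ℝ => ∑ k ∈ s, (r ^ k *
      ‖PowerSeries.coeff k (taylorSeriesAtZero (ω * fun z => p.eval z))‖) ^ 2)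
      (nhdsWithin 1 (Set.Iio 1)) (nhds (∑ k ∈ s, ((1 : ℝ) ^ k *
      ‖PowerSeries.coeff k (taylorSeriesAtZero (ω * fun z => p.eval z))‖) ^ 2)) :=
    Filter.Tendsto.mono_left (Continuous.tendsto (by fun_prop) 1) nhdsWithin_le_nhds
  simp only [one_pow, one_mul] at hlim
  refine le_of_tendsto hlim ?_
  filter_upwards [Ioo_mem_nhdsLT (zero_lt_one' ℝ)] with r hr
  exact sum_sq_coeff_taylorSeriesAtZero_le hg p hle hr.1 hr.2 s

/-! ### Coefficients from the differential equation -/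

/-- The differential equation `z f' = f (1 + sinh ω)` determines the first Taylor coefficients of
`f` in terms of those of `ω`. -/
theorem coeff_eq_of_mul_deriv_eq {f ω : ℂ → ℂ} {a : ℕ → ℂ} {c : ℕ → ℂ}
    (hf : DifferentiableOn ℂ f unitDisc) (ha : HasNormalizedExpansion f a)
    (hω : DifferentiableOn ℂ ω unitDisc) (hω0 : ω 0 = 0)
    (hc : ∀ n, PowerSeries.coeff n (taylorSeriesAtZero ω) = c n)
    (h : ∀ z ∈ unitDisc, z * deriv f z = f z * (1 + Complex.sinh (ω z))) :
    a 2 = c 1 ∧ 2 * a 3 = c 2 + c 1 ^ 2 ∧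
    3 * a 4 = c 3 + 3 / 2 * (c 1 * c 2) + 2 / 3 * c 1 ^ 3 ∧
    4 * a 5 = c 4 + 4 / 3 * (c 1 * c 3) + 1 / 2 * c 2 ^ 2 + 3 / 2 * (c 1 ^ 2 * c 2) +
      7 / 18 * c 1 ^ 4 := by
  have hnhds : unitDisc ∈ nhds (0 : ℂ) := Metric.ball_mem_nhds _ one_pos
  have hfa := analyticAt_zero_of_differentiableOn hf
  have hωa := analyticAt_zero_of_differentiableOn hω
  set P : ℂ → ℂ := fun z => Complex.sinh (ω z) with hP
  set Q : ℂ → ℂ := fun z => Complex.cosh (ω z) with hQ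
  have hPa : AnalyticAt ℂ P 0 := analyticAt_zero_of_differentiableOn hω.csinh
  have hQa : AnalyticAt ℂ Q 0 := analyticAt_zero_of_differentiableOn hω.ccosh
  have hωd : ∀ᶠ z in nhds 0, HasDerivAt ω (deriv ω z) z := by
    filter_upwards [Metric.isOpen_ball.mem_nhds (Metric.mem_ball_self one_pos)] with z hz
    exact (hω.differentiableAt (Metric.isOpen_ball.mem_nhds hz)).hasDerivAt
  -- The coupled system `P' = Q ω'`, `Q' = P ω'` yields the coefficients of `sinh ω` recursively,
  -- without composing power series.
  have hP' : deriv P =ᶠ[nhds 0] Q * deriv ω := by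
    filter_upwards [hωd] with z hz
    exact hz.csinh.deriv
  have hQ' : deriv Q =ᶠ[nhds 0] P * deriv ω := by
    filter_upwards [hωd] with z hz
    exact hz.ccosh.deriv
  have hf' : id * deriv f =ᶠ[nhds 0] f + f * P := by
    filter_upwards [hnhds] with z hz
    simp only [Pi.mul_apply, Pi.add_apply, h z hz, hP, id]
    ring
  have eP := taylorSeriesAtZero_congr hP'
  have eQ := taylorSeriesAtZero_congr hQ'
  have ef := taylorSeriesAtZero_congr hf'
  rw [taylorSeriesAtZero_mul hQa hωa.deriv, taylorSeriesAtZero_deriv, taylorSeriesAtZero_deriv]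
    at eP
  rw [taylorSeriesAtZero_mul hPa hωa.deriv, taylorSeriesAtZero_deriv, taylorSeriesAtZero_deriv]
    at eQ
  rw [taylorSeriesAtZero_mul analyticAt_id hfa.deriv, taylorSeriesAtZero_id,
    taylorSeriesAtZero_deriv, taylorSeriesAtZero_add hfa (hfa.mul hPa),
    taylorSeriesAtZero_mul hfa hPa] at ef
  have p0 : PowerSeries.coeff 0 (taylorSeriesAtZero P) = 0 := by
    rw [coeff_zero_taylorSeriesAtZero, hP]; simp [hω0]
  have q0 : PowerSeries.coeff 0 (taylorSeriesAtZero Q) = 1 := by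
    rw [coeff_zero_taylorSeriesAtZero, hQ]; simp [hω0]
  have hfcoeff : ∀ n, PowerSeries.coeff n (taylorSeriesAtZero f) =
      if n = 0 then 0 else if n = 1 then 1 else a n := by
    refine coeff_taylorSeriesAtZero_eq_of_hasSum fun z hz => ?_
    rw [← hasSum_nat_add_iff' 2]
    simpa [Finset.sum_range_succ] using ha z hz
  have eP' := fun n => congrArg (PowerSeries.coeff n) eP
  have eQ' := fun n => congrArg (PowerSeries.coeff n) eQ
  have ef' := fun n => congrArg (PowerSeries.coeff n) ef
  simp only [PowerSeries.coeff_derivative, PowerSeries.coeff_mul, hc,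
    Finset.Nat.sum_antidiagonal_eq_sum_range_succ_mk] at eP' eQ'
  simp only [map_add, PowerSeries.coeff_mul, hfcoeff,
    Finset.Nat.sum_antidiagonal_eq_sum_range_succ_mk, PowerSeries.coeff_X,
    PowerSeries.coeff_derivative] at ef'
  have P1 := eP' 0
  have P2 := eP' 1
  have P3 := eP' 2
  have P4 := eP' 3
  have Q1 := eQ' 0
  have Q2 := eQ' 1
  have Q3 := eQ' 2
  have F2 := ef' 2
  have F3 := ef' 3
  have F4 := ef' 4
  have F5 := ef' 5
  have c0 : c 0 = 0 := by rw [← hc, coeff_zero_taylorSeriesAtZero, hω0]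
  simp [Finset.sum_range_succ, p0, q0] at P1 P2 P3 P4 Q1 Q2 Q3 F2 F3 F4 F5
  simp only [P1, Q1, zero_mul, add_zero] at P2 P3 P4 Q2 Q3 F2 F3 F4 F5
  have P2' : PowerSeries.coeff 2 (taylorSeriesAtZero P) = c 2 := by linear_combination P2 / 2
  have Q2' : PowerSeries.coeff 2 (taylorSeriesAtZero Q) = c 1 ^ 2 / 2 := by
    linear_combination Q2 / 2
  rw [P2'] at Q3 F3 F4 F5
  rw [Q2'] at P3 P4
  have P3' : PowerSeries.coeff 3 (taylorSeriesAtZero P) = c 3 + c 1 ^ 3 / 6 := by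
    linear_combination P3 / 3
  have Q3' : PowerSeries.coeff 3 (taylorSeriesAtZero Q) = c 1 * c 2 := by
    linear_combination Q3 / 3
  rw [Q3'] at P4
  have P4' : PowerSeries.coeff 4 (taylorSeriesAtZero P) = c 4 + c 1 ^ 2 * c 2 / 2 := by
    linear_combination P4 / 4
  rw [P3'] at F4 F5
  rw [P4'] at F5
  have h2 : a 2 = c 1 := by linear_combination F2
  rw [h2] at F3 F4 F5
  have h3 : a 3 = (c 2 + c 1 ^ 2) / 2 := by linear_combination F3 / 2
  rw [h3] at F4 F5
  have h4 : a 4 = (c 3 + 3 / 2 * (c 1 * c 2) + 2 / 3 * c 1 ^ 3) / 3 := by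
    linear_combination F4 / 3
  rw [h4] at F5
  refine ⟨h2, ?_, ?_, ?_⟩
  · linear_combination 2 * h3
  · linear_combination 3 * h4
  · linear_combination F5

/-! ### Bounds for the coefficient functionals -/

/-- The contraction inequality for a Schwarz function with coefficients `c` and a cubic. -/
theorem IsSchwarz.sum_sq_le_of_cubic {ω : ℂ → ℂ} (hω : IsSchwarz ω) {c : ℕ → ℂ}
    (hc : ∀ n, PowerSeries.coeff n (taylorSeriesAtZero ω) = c n) (h₁ h₂ h₃ : ℂ) :
    ‖c 1‖ ^ 2 + ‖c 2 + h₁ * c 1‖ ^ 2 + ‖c 3 + h₁ * c 2 + h₂ * c 1‖ ^ 2 +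
      ‖c 4 + h₁ * c 3 + h₂ * c 2 + h₃ * c 1‖ ^ 2 ≤
      1 + ‖h₁‖ ^ 2 + ‖h₂‖ ^ 2 + ‖h₃‖ ^ 2 := by
  have c0 : c 0 = 0 := by
    rw [← hc, coeff_zero_taylorSeriesAtZero]
    simpa using hω.2 0 (Metric.mem_ball_self one_pos)
  set p : Polynomial ℂ := Polynomial.C h₃ * Polynomial.X ^ 3 + Polynomial.C h₂ * Polynomial.X ^ 2 +
    Polynomial.C h₁ * Polynomial.X + Polynomial.C 1 with hp
  have p0 : p.coeff 0 = 1 := by simp [hp]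
  have p1 : p.coeff 1 = h₁ := by simp [hp, Polynomial.coeff_one]
  have p2 : p.coeff 2 = h₂ := by simp [hp, Polynomial.coeff_one]
  have p3 : p.coeff 3 = h₃ := by simp [hp, Polynomial.coeff_one]
  have hsupp : p.support ⊆ Finset.range 4 := fun k hk => by
    rw [Finset.mem_range, Nat.lt_succ_iff]
    exact (Polynomial.le_natDegree_of_mem_supp k hk).trans Polynomial.natDegree_cubic_le
  -- Orders `0` to `4` of `ω p` are kept; order `0` vanishes because `c 0 = 0`.
  have h := (hω.sum_sq_coeff_mul_le p (Finset.range 5)).trans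
    (Finset.sum_le_sum_of_subset_of_nonneg hsupp fun _ _ _ => by positivity)
  simp only [PowerSeries.coeff_mul, Polynomial.coeff_coe, hc,
    Finset.Nat.sum_antidiagonal_eq_sum_range_succ_mk] at h
  simp [Finset.sum_range_succ, p0, p1, p2, p3, c0] at h
  rwa [add_comm _ (c 2), show c 1 * h₂ + c 2 * h₁ + c 3 = c 3 + h₁ * c 2 + h₂ * c 1 by ring,
    show c 1 * h₃ + c 2 * h₂ + c 3 * h₁ + c 4 = c 4 + h₁ * c 3 + h₂ * c 2 + h₃ * c 1 by ring,
    mul_comm (c 1) h₁] at h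

/-- Each `h_j` is chosen as a multiple, of modulus less than or equal to `1`, of the order `j`
coefficient of `ω p`, plus a multiple of a power of `c 1` that corrects the remaining terms. -/
theorem IsSchwarz.coeff_functional_bounds {ω : ℂ → ℂ} (hω : IsSchwarz ω) {c : ℕ → ℂ}
    (hc : ∀ n, PowerSeries.coeff n (taylorSeriesAtZero ω) = c n) :
    ‖c 1‖ ≤ 1 ∧ ‖c 2 + c 1 ^ 2‖ ≤ 1 ∧ ‖c 3 + 3 / 2 * (c 1 * c 2) + 2 / 3 * c 1 ^ 3‖ ≤ 1 ∧
    ‖c 4 + 4 / 3 * (c 1 * c 3) + 1 / 2 * c 2 ^ 2 + 3 / 2 * (c 1 ^ 2 * c 2) +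
      7 / 18 * c 1 ^ 4‖ ≤ 1 := by
  have key := hω.sum_sq_le_of_cubic hc
  have h1 : ‖c 1‖ ≤ 1 := by
    have h := key 0 0 0
    simp only [norm_zero] at h
    nlinarith [norm_nonneg (c 1), sq_nonneg ‖c 2 + 0 * c 1‖,
      sq_nonneg ‖c 3 + 0 * c 2 + 0 * c 1‖, sq_nonneg ‖c 4 + 0 * c 3 + 0 * c 2 + 0 * c 1‖]
  have hx := norm_nonneg (c 1)
  refine ⟨h1, ?_, ?_, ?_⟩
  -- With `h₁ = c 1` the term `|c 1|²` cancels from both sides.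
  · have h := key (c 1) 0 0
    simp only [norm_zero] at h
    rw [← sq] at h
    nlinarith [norm_nonneg (c 2 + c 1 ^ 2), sq_nonneg ‖c 3 + c 1 * c 2 + 0 * c 1‖,
      sq_nonneg ‖c 4 + c 1 * c 3 + 0 * c 2 + 0 * c 1‖]
  -- The factor `3/4` splits the `3/2` of `c 1 * c 2` evenly between `h₁ c 2` and `h₂ c 1`; `5/48 =
  -- 2/3 - 9/16` then corrects the `c 1 ^ 3` term.
  · have h := key (3 / 4 * c 1) (3 / 4 * (c 2 + 3 / 4 * c 1 * c 1) + 5 / 48 * c 1 ^ 2) 0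
    set u := c 2 + 3 / 4 * c 1 * c 1 with hu
    have e1 : c 3 + 3 / 4 * c 1 * c 2 + (3 / 4 * u + 5 / 48 * c 1 ^ 2) * c 1 =
        c 3 + 3 / 2 * (c 1 * c 2) + 2 / 3 * c 1 ^ 3 := by rw [hu]; ring
    have n1 : ‖3 / 4 * c 1‖ = 3 / 4 * ‖c 1‖ := by simp
    have n2 : ‖3 / 4 * u + 5 / 48 * c 1 ^ 2‖ ≤ 3 / 4 * ‖u‖ + 5 / 48 * ‖c 1‖ ^ 2 :=
      (norm_add_le _ _).trans_eq (by simp)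
    have n2' := pow_le_pow_left₀ (norm_nonneg _) n2 2
    rw [e1, n1, norm_zero] at h
    have hx4 : (‖c 1‖ ^ 2) ^ 2 ≤ ‖c 1‖ ^ 2 := by
      rw [sq (‖c 1‖ ^ 2)]; exact mul_le_of_le_one_left (by positivity) (pow_le_one₀ hx h1)
    refine (sq_le_one_iff₀ (norm_nonneg _)).mp ?_
    nlinarith [sq_nonneg (‖u‖ - ‖c 1‖ ^ 2),
      sq_nonneg ‖c 4 + 3 / 4 * c 1 * c 3 + (3 / 4 * u + 5 / 48 * c 1 ^ 2) * c 2 + 0 * c 1‖]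
  · set u := c 2 + 2 / 3 * c 1 * c 1 with hu
    set s := c 3 + 2 / 3 * c 1 * c 2 + (1 / 2 * u + 7 / 18 * c 1 ^ 2) * c 1 with hs
    -- Here `2/3` is half of the `4/3` on `c 1 * c 3`, and `1/2` matches `c 2 ^ 2`. Then `7/18` and
    -- `-5/54` are forced by `c 1 ^ 2 * c 2` and `c 1 ^ 4`.
    have h := key (2 / 3 * c 1) (1 / 2 * u + 7 / 18 * c 1 ^ 2) (2 / 3 * s + -(5 / 54) * c 1 ^ 3)
    rw [← hu, ← hs] at h
    have e1 : c 4 + 2 / 3 * c 1 * c 3 + (1 / 2 * u + 7 / 18 * c 1 ^ 2) * c 2 +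
        (2 / 3 * s + -(5 / 54) * c 1 ^ 3) * c 1 =
        c 4 + 4 / 3 * (c 1 * c 3) + 1 / 2 * c 2 ^ 2 + 3 / 2 * (c 1 ^ 2 * c 2) +
          7 / 18 * c 1 ^ 4 := by rw [hs, hu]; ring
    have n1 : ‖2 / 3 * c 1‖ = 2 / 3 * ‖c 1‖ := by simp
    have n2 : ‖1 / 2 * u + 7 / 18 * c 1 ^ 2‖ ≤ 1 / 2 * ‖u‖ + 7 / 18 * ‖c 1‖ ^ 2 :=
      (norm_add_le _ _).trans_eq (by simp)
    have n3 : ‖2 / 3 * s + -(5 / 54) * c 1 ^ 3‖ ≤ 2 / 3 * ‖s‖ + 5 / 54 * ‖c 1‖ ^ 3 :=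
      (norm_add_le _ _).trans_eq (by simp)
    have n2' := pow_le_pow_left₀ (norm_nonneg _) n2 2
    have n3' := pow_le_pow_left₀ (norm_nonneg _) n3 2
    rw [e1, n1] at h
    have hx4 : (‖c 1‖ ^ 2) ^ 2 ≤ ‖c 1‖ ^ 2 := by
      rw [sq (‖c 1‖ ^ 2)]; exact mul_le_of_le_one_left (by positivity) (pow_le_one₀ hx h1)
    have hx6 : (‖c 1‖ ^ 3) ^ 2 ≤ ‖c 1‖ ^ 2 := by
      rw [← pow_mul]; exact pow_le_pow_of_le_one hx h1 (by norm_num)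
    refine (sq_le_one_iff₀ (norm_nonneg _)).mp ?_
    -- The squares bound the cross terms of `n2'` and `n3'`; since `|c 1| ≤ 1`, all remaining powers
    -- are absorbed by `|c 1|²`.
    nlinarith [sq_nonneg (‖u‖ - 2 / 3 * ‖c 1‖ ^ 2), sq_nonneg (‖s‖ - ‖c 1‖ ^ 3)]

/-! ### Coefficient bounds for the class -/

lemma HasNormalizedExpansion.map_zero {f : ℂ → ℂ} {a : ℕ → ℂ} (ha : HasNormalizedExpansion f a) :
    f 0 = 0 := by
  have h := ha 0 (Metric.mem_ball_self one_pos)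
  simpa using h.unique (by simp)

lemma mul_deriv_eq_of_starQuotient {f ω : ℂ → ℂ} (hf0 : f 0 = 0)
    (hne : ∀ z ∈ unitDisc, z ≠ 0 → f z ≠ 0)
    (h : ∀ z ∈ unitDisc, starQuotient f z - 1 = Complex.sinh (ω z)) :
    ∀ z ∈ unitDisc, z * deriv f z = f z * (1 + Complex.sinh (ω z)) := by
  intro z hz
  rcases eq_or_ne z 0 with rfl | hz0
  · simp [hf0]
  · have := hne z hz hz0
    rw [← h z hz, starQuotient, if_neg hz0]
    field_simp
    ring

theorem norm_coeff_le_of_mem_classGsh {f : ℂ → ℂ} {a : ℕ → ℂ} (hf : f ∈ classGsh)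
    (ha : HasNormalizedExpansion f a) :
    ‖a 2‖ ≤ 1 ∧ ‖a 3‖ ≤ 1 / 2 ∧ ‖a 4‖ ≤ 1 / 3 ∧ ‖a 5‖ ≤ 1 / 4 := by
  obtain ⟨⟨hfd, -⟩, hne, ω, hω, h⟩ := hf
  have hω0 : ω 0 = 0 := by simpa using hω.2 0 (Metric.mem_ball_self one_pos)
  obtain ⟨h2, h3, h4, h5⟩ := coeff_eq_of_mul_deriv_eq hfd ha hω.1 hω0 (fun _ => rfl)
    (mul_deriv_eq_of_starQuotient ha.map_zero hne h)
  obtain ⟨b2, b3, b4, b5⟩ := hω.coeff_functional_bounds (fun _ => rfl)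
  rw [← h3] at b3
  rw [← h4] at b4
  rw [← h5] at b5
  simp only [norm_mul, Complex.norm_ofNat] at b3 b4 b5
  refine ⟨h2 ▸ b2, ?_, ?_, ?_⟩ <;> linarith

/-! ### Extremal functions and sharpness -/

/-- On the unit disc the extremal function is `z exp (G z)`, where `G` is the primitive vanishing
at `0` of an analytic function `S` with `z S(z) = sinh (z ^ (n - 1))`. -/
lemma exists_extremalFunction_eq {n : ℕ} (hn : 2 ≤ n) :
    ∃ G S : ℂ → ℂ, G 0 = 0 ∧ (∀ z ∈ unitDisc, HasDerivAt G (S z) z) ∧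
      (∀ z, z * S z = Complex.sinh (z ^ (n - 1))) ∧
      ∀ z ∈ unitDisc, extremalFunction n z = z * Complex.exp (G z) := by
  set k : ℂ → ℂ := fun z => Complex.sinh (z ^ (n - 1)) with hk
  have hk0 : k 0 = 0 := by simp [hk, zero_pow (show n - 1 ≠ 0 by omega)]
  have hkd : DifferentiableOn ℂ k unitDisc := by
    apply Differentiable.differentiableOn
    fun_prop
  have hSd : DifferentiableOn ℂ (dslope k 0) unitDisc :=
    (Complex.differentiableOn_dslope (Metric.ball_mem_nhds _ one_pos)).mpr hkd
  obtain ⟨G, hG0, hG⟩ := (DifferentiableOn.isExactOn_ball hSd).with_val_at 0 0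
  refine ⟨G, dslope k 0, hG0, hG, fun z => ?_, fun z hz => ?_⟩
  · have := sub_smul_dslope k 0 z
    simpa [hk0] using this
  · have hmem : ∀ u ∈ Set.uIcc (0 : ℝ) 1, (u : ℂ) * z ∈ unitDisc := fun u hu => by
      rw [Set.uIcc_of_le zero_le_one] at hu
      rw [unitDisc, mem_ball_zero_iff] at hz ⊢
      rw [norm_mul, Complex.norm_real, Real.norm_of_nonneg hu.1]
      exact (mul_le_of_le_one_left (norm_nonneg _) hu.2).trans_lt hz
    have hderiv : ∀ u ∈ Set.uIcc (0 : ℝ) 1,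
        HasDerivAt (fun u : ℝ => G ((u : ℂ) * z)) (dslope k 0 ((u : ℂ) * z) * z) u := by
      intro u hu
      have h1 : HasDerivAt (fun u : ℝ => (u : ℂ) * z) z u := by
        simpa using (Complex.ofRealCLM.hasDerivAt (x := u)).mul_const z
      exact (hG _ (hmem u hu)).comp u h1
    have hcont : ContinuousOn (fun u : ℝ => dslope k 0 ((u : ℂ) * z) * z) (Set.uIcc 0 1) := by
      refine ContinuousOn.mul (hSd.continuousOn.comp ?_ hmem) continuousOn_const
      fun_prop
    have hFTC := intervalIntegral.integral_eq_sub_of_hasDerivAt hderiv hcont.intervalIntegrable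
    simp only [Complex.ofReal_one, Complex.ofReal_zero, one_mul, zero_mul, hG0, sub_zero] at hFTC
    rw [extremalFunction, segmentIntegral, ← hFTC]
    congr 2
    -- The integrand takes the junk value of `0 / 0` at `u = 0`, which may differ from `dslope`; the
    -- half-open interval excludes that point.
    refine intervalIntegral.integral_congr_ae (Filter.Eventually.of_forall fun u hu => ?_)
    rw [Set.uIoc_of_le zero_le_one] at hu
    rcases eq_or_ne z 0 with rfl | hz0
    · simp
    · have hne : (u : ℂ) * z ≠ 0 := mul_ne_zero (by exact_mod_cast hu.1.ne') hz0
      simp only [dslope_of_ne _ hne, slope_def_field, hk0, sub_zero]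
      rfl

lemma isSchwarz_pow {m : ℕ} (hm : 1 ≤ m) : IsSchwarz fun z => z ^ m := by
  refine ⟨(differentiable_pow m).differentiableOn, fun z hz => ?_⟩
  rw [norm_pow]
  exact pow_le_of_le_one (norm_nonneg _) (mem_ball_zero_iff.mp hz).le (by omega)

lemma exists_hasNormalizedExpansion {f : ℂ → ℂ} (hf : DifferentiableOn ℂ f unitDisc)
    (h0 : f 0 = 0) (h1 : deriv f 0 = 1) : ∃ a, HasNormalizedExpansion f a := by
  refine ⟨fun n => PowerSeries.coeff n (taylorSeriesAtZero f), fun z hz => ?_⟩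
  have h := (hasSum_nat_add_iff' 2).mpr (hasSum_taylorSeriesAtZero hf hz)
  simpa [Finset.sum_range_succ, coeff_taylorSeriesAtZero, h0, h1] using h

theorem extremalFunction_starQuotient {n : ℕ} (hn : 2 ≤ n) :
    extremalFunction n ∈ classA ∧ (∀ z ∈ unitDisc, z ≠ 0 → extremalFunction n z ≠ 0) ∧
      ∀ z ∈ unitDisc, starQuotient (extremalFunction n) z - 1 = Complex.sinh (z ^ (n - 1)) := by
  obtain ⟨G, S, hG0, hG, hS, hE⟩ := exists_extremalFunction_eq hn
  have hderiv : ∀ z ∈ unitDisc, HasDerivAt (extremalFunction n)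
      (Complex.exp (G z) * (1 + Complex.sinh (z ^ (n - 1)))) z := by
    intro z hz
    have h := (hasDerivAt_id z).mul (hG z hz).cexp
    have heq : extremalFunction n =ᶠ[nhds z] id * fun z => Complex.exp (G z) := by
      filter_upwards [Metric.isOpen_ball.mem_nhds hz] with w hw
      exact hE w hw
    refine (h.congr_of_eventuallyEq heq).congr_deriv ?_
    rw [← hS z, id]
    ring
  have hm0 : (0 : ℂ) ∈ unitDisc := Metric.mem_ball_self one_pos
  have hd : DifferentiableOn ℂ (extremalFunction n) unitDisc := fun z hz =>
    (hderiv z hz).differentiableAt.differentiableWithinAt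
  refine ⟨⟨hd, exists_hasNormalizedExpansion hd ?_ ?_⟩, fun z hz hz0 => ?_, fun z hz => ?_⟩
  · simp [hE 0 hm0]
  · simp [(hderiv 0 hm0).deriv, hG0, zero_pow (show n - 1 ≠ 0 by omega)]
  · rw [hE z hz]
    exact mul_ne_zero hz0 (Complex.exp_ne_zero _)
  · rcases eq_or_ne z 0 with rfl | hz0
    · simp [starQuotient, zero_pow (show n - 1 ≠ 0 by omega)]
    · have := Complex.exp_ne_zero (G z)
      simp only [starQuotient, if_neg hz0, (hderiv z hz).deriv, hE z hz]
      field_simp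
      ring

theorem norm_coeff_eq_of_mul_deriv_eq {n : ℕ} (hn : 2 ≤ n) (hn' : n ≤ 5) {f : ℂ → ℂ}
    {a : ℕ → ℂ} (hf : DifferentiableOn ℂ f unitDisc) (ha : HasNormalizedExpansion f a)
    (h : ∀ z ∈ unitDisc, z * deriv f z = f z * (1 + Complex.sinh (z ^ (n - 1)))) :
    ‖a n‖ = 1 / ((n : ℝ) - 1) := by
  obtain ⟨h2, h3, h4, h5⟩ := coeff_eq_of_mul_deriv_eq (c := fun k => if k = n - 1 then 1 else 0)
    hf ha (differentiable_pow (n - 1)).differentiableOn (zero_pow (by omega))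
    (fun k => by rw [taylorSeriesAtZero_pow, PowerSeries.coeff_X_pow]) h
  interval_cases n
  · norm_num at h2
    norm_num [h2]
  · norm_num at h3
    rw [eq_div_of_mul_eq two_ne_zero ((mul_comm _ _).trans h3)]
    norm_num
  · norm_num at h4
    rw [eq_div_of_mul_eq three_ne_zero ((mul_comm _ _).trans h4)]
    norm_num
  · norm_num at h5
    rw [eq_div_of_mul_eq (by norm_num : (4 : ℂ) ≠ 0) ((mul_comm _ _).trans h5)]
    norm_num

theorem mainTheorem1 :
    (∀ (f : ℂ → ℂ) (a : ℕ → ℂ), f ∈ classGsh → HasNormalizedExpansion f a →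
      ‖a 2‖ ≤ 1 ∧ ‖a 3‖ ≤ 1 / 2 ∧ ‖a 4‖ ≤ 1 / 3 ∧ ‖a 5‖ ≤ 1 / 4) ∧
    (∀ n : ℕ, 2 ≤ n → n ≤ 5 →
      extremalFunction n ∈ classGsh ∧
      ∃ a : ℕ → ℂ, HasNormalizedExpansion (extremalFunction n) a ∧
        ‖a n‖ = 1 / ((n : ℝ) - 1)) := by
  refine ⟨fun f a hf ha => norm_coeff_le_of_mem_classGsh hf ha, fun n hn hn' => ?_⟩
  obtain ⟨hA, hne, hq⟩ := extremalFunction_starQuotient hn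
  obtain ⟨hd, a, ha⟩ := hA
  exact ⟨⟨⟨hd, a, ha⟩, hne, _, isSchwarz_pow (by omega), hq⟩, a, ha,
    norm_coeff_eq_of_mul_deriv_eq hn hn' hd ha
      (mul_deriv_eq_of_starQuotient ha.map_zero hne hq)⟩
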